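/- Let $\mathbb K\in\{\mathbb R,\mathbb C\}$ and let $J^\infty$ be the jet space with coordinates $(t,u_0,u_1,u_2,\dots)$, $u_0=u$, equipped with the product topology. A differential function $f=f[u]$ on an open set $\Omega\subseteq J^\infty$ is a smooth ($\mathbb K$-smooth) $\mathbb K$-valued function on $\Omega$ of $t$ and finitely many of the $u_k$. Let $\mathrm D_t=\partial_t+\sum_{k\ge0}u_{k+1}\partial_{u_k}$ be the total derivative, and let $\mathrm W(f^1,\dots,f^k)=\det(\mathrm D_t^{l'-1}f^l)_{l,l'=1,\dots,k}$. If $\mathrm W(f^1,\dots,f^k)$ is nonvanishing, $\mathrm{DT}[f^1,\dots,f^k]$ denotes the linear differential operator $G\mapsto \mathrm W(f^1,\dots,f^k,G)/\mathrm W(f^1,\dots,f^k)=\sum_{i=0}^k\psi_i\mathrm D_t^iG$, and $\mathrm{DT}[f^1,\dots,f^k]^\dagger$ denotes its formal adjoint $G\mapsto\sum_{i=0}^k(-\mathrm D_t)^i(\psi_iG)$. **Proposition.** Let $L,\lambda^1,\dots,\lambda^p,H$ be differential functions on an open set $\Omega\subseteq J^\infty$ such that $\mathrm W(\lambda^1,\dots,\lambda^p)$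 does not vanish on $\Omega$ and $$L=\mathrm{DT}[\lambda^1,\dots,\lambda^p]^\dagger H\quad\text{on }\Omega.$$ Let $\mathcal T$: $\tilde t=T(t,u)$, $\tilde u=U(t,u)$ be a point transformation, that is, a smooth diffeomorphism between two open subsets of $\mathbb K^2$, such that for every point of $\Omega$ the pair $(t,u)$ belongs to the domain of $\mathcal T$ and $\mathrm D_tT\neq0$. Let $\operatorname{pr}\mathcal T\colon(t,u_0,u_1,\dots)\mapsto(\tilde t,\tilde u_0,\tilde u_1,\dots)$ be its prolongation to $\Omega$, given by $\tilde t=T$, $\tilde u_0=U$, $\tilde u_{k+1}=\mathrm D_t\tilde u_k/\mathrm D_tT$, and set $\tilde\Omega=\operatorname{pr}\mathcal T(\Omega)$. Suppose that $\mathcal T$ maps $L$ to a differential function $\tilde L[\tilde u]$ on $\tilde\Omega$ with $\tilde L[\tilde u]=\Lambda[u]L[u]$, that is, $\tilde L\circ\operatorname{pr}\mathcal T=\Lambda L$ on $\Omega$, where $\Lambda$ is a nonvanishing differential function on $\Omega$. Then $\tilde\Omega$ is open, $\operatorname{pr}\mathcal T$ is injective on $\Omega$, and there are differential functions $\tilde\lambda^1[\tilde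 u],\dots,\tilde\lambda^p[\tilde u],\tilde H[\tilde u]$ on $\tilde\Omega$ determined by $$\tilde\lambda^s\circ\operatorname{pr}\mathcal T=\frac{\lambda^s}{\Lambda\,\mathrm D_tT}\quad(s=1,\dots,p),\qquad \tilde H\circ\operatorname{pr}\mathcal T=\Lambda(\mathrm D_tT)^pH\qquad\text{on }\Omega;$$ the Wronskian $\mathrm W(\tilde\lambda^1,\dots,\tilde\lambda^p)$ does not vanish on $\tilde\Omega$, and $$\tilde L=\mathrm{DT}[\tilde\lambda^1,\dots,\tilde\lambda^p]^\dagger\tilde H\quad\text{on }\tilde\Omega,$$ where on $\tilde\Omega$ the Wronskian and the Darboux operator are taken with respect to the total derivative $\mathrm D_{\tilde t}=\partial_{\tilde t}+\sum_{k\ge0}\tilde u_{k+1}\partial_{\tilde u_k}$ in the coordinates with tildes. -/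

import Mathlib

open scoped ContDiff Topology

noncomputable section

namespace InverseCL

variable {𝕜 : Type*} [RCLike 𝕜]

/-- The infinite jet space `J^∞(t|u)` with one independent variable `t` and one dependent variable
`u` over the underlying field: a point is `(t, (u₀, u₁, u₂, …))`, where `u₀ = u` and `u_k` stands for
the `k`-th derivative of `u`.  It carries the product (inverse limit) topology. -/
abbrev Jet (𝕜 : Type*) : Type _ := 𝕜 × (ℕ → 𝕜)

/-- The projection of `J^∞` onto the jet space of order `n`. -/
def truncate (n : ℕ) (z : Jet 𝕜) : 𝕜 × (Fin (n + 1) → 𝕜) := (z.1, fun i => z.2 i)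

/-- `f` is a differential function on the set `Ω` of `J^∞` (to be used with `Ω` open): a smooth
function of `t` and of finitely many of the variables `u_k`. -/
def IsDifferentialFunction (Ω : Set (Jet 𝕜)) (f : Jet 𝕜 → 𝕜) : Prop :=
  ∃ (n : ℕ) (g : 𝕜 × (Fin (n + 1) → 𝕜) → 𝕜),
    ContDiffOn 𝕜 ∞ g (truncate n '' Ω) ∧ ∀ z ∈ Ω, f z = g (truncate n z)

/-- The partial derivative `∂f/∂t` on the jet space. -/
def partialT (f : Jet 𝕜 → 𝕜) (z : Jet 𝕜) : 𝕜 :=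
  deriv (fun s => f (s, z.2)) z.1

/-- The partial derivative `∂f/∂u_k` on the jet space. -/
def partialU (k : ℕ) (f : Jet 𝕜 → 𝕜) (z : Jet 𝕜) : 𝕜 :=
  deriv (fun s => f (z.1, Function.update z.2 k s)) (z.2 k)

/-- The operator of total derivative `D_t = ∂_t + ∑_k u_{k+1} ∂_{u_k}`.  For a differential function
only finitely many terms of the sum are nonzero. -/
def totalDeriv (f : Jet 𝕜 → 𝕜) (z : Jet 𝕜) : 𝕜 :=
  partialT f z + ∑ᶠ k : ℕ, z.2 (k + 1) * partialU k f z

/-- The Wronskian `W(f¹, …, f^k) = det (D_t^{l'-1} f^l)` in the total derivative. -/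
def wronskian {k : ℕ} (f : Fin k → Jet 𝕜 → 𝕜) (z : Jet 𝕜) : 𝕜 :=
  Matrix.det (Matrix.of fun l l' : Fin k => (totalDeriv^[(l' : ℕ)] (f l)) z)

/-- The action on `g` of the operator `∑_{i=0}^m ψ_i D_t^i` with coefficients `ψ_0, …, ψ_m`. -/
def opApply {m : ℕ} (ψ : Fin (m + 1) → Jet 𝕜 → 𝕜) (g : Jet 𝕜 → 𝕜) (z : Jet 𝕜) : 𝕜 :=
  ∑ i : Fin (m + 1), ψ i z * (totalDeriv^[(i : ℕ)] g) z

/-- The action on `g` of the formal adjoint of `∑_{i=0}^m ψ_i D_t^i`, that is,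
`∑_{i=0}^m (-D_t)^i (ψ_i g)`. -/
def opAdjointApply {m : ℕ} (ψ : Fin (m + 1) → Jet 𝕜 → 𝕜) (g : Jet 𝕜 → 𝕜) (z : Jet 𝕜) : 𝕜 :=
  ∑ i : Fin (m + 1), (-1) ^ (i : ℕ) * (totalDeriv^[(i : ℕ)] (fun w => ψ i w * g w)) z

/-- The coefficients of the Darboux operator `DT[f¹, …, f^k] : G ↦ W(f¹, …, f^k, G) / W(f¹, …, f^k)`:
the coefficient of `D_t^i` is the cofactor of `D_t^i G` in the upper Wronskian, divided by
`W(f¹, …, f^k)`; see `darboux_apply`. -/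
def darbouxCoeff {k : ℕ} (f : Fin k → Jet 𝕜 → 𝕜) (i : Fin (k + 1)) (z : Jet 𝕜) : 𝕜 :=
  (-1) ^ (k + (i : ℕ)) *
    Matrix.det (Matrix.of fun l j : Fin k => (totalDeriv^[(i.succAbove j : ℕ)] (f l)) z) /
      wronskian f z

/-- The operator with the coefficients `darbouxCoeff f` is the Darboux transformation. -/
theorem darboux_apply {k : ℕ} (f : Fin k → Jet 𝕜 → 𝕜) (G : Jet 𝕜 → 𝕜) (z : Jet 𝕜) :
    opApply (darbouxCoeff f) G z =
      wronskian (Fin.snoc f G : Fin (k + 1) → Jet 𝕜 → 𝕜) z / wronskian f z := by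
  unfold opApply
  conv_rhs => rw [wronskian, Matrix.det_succ_row _ (Fin.last k)]
  rw [Finset.sum_div]
  refine Finset.sum_congr rfl fun i _ => ?_
  have h : (Matrix.of fun l l' : Fin (k + 1) =>
        (totalDeriv^[(l' : ℕ)] ((Fin.snoc f G : Fin (k + 1) → Jet 𝕜 → 𝕜) l)) z).submatrix
          (Fin.last k).succAbove i.succAbove =
      Matrix.of fun l j : Fin k => (totalDeriv^[(i.succAbove j : ℕ)] (f l)) z := by
    ext l j
    simp
  rw [h]
  simp only [darbouxCoeff, Matrix.of_apply, Fin.snoc_last, Fin.val_last]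
  ring

/-- `DT[f¹, …, f^k]^† H`, the formally adjoint Darboux operator applied to `H`. -/
def darbouxAdjoint {k : ℕ} (f : Fin k → Jet 𝕜 → 𝕜) (H : Jet 𝕜 → 𝕜) : Jet 𝕜 → 𝕜 :=
  opAdjointApply (darbouxCoeff f) H

/-- `L = DT[l¹, …, l^p]^† H` on `Ω`, for differential functions `L`, `l^s`, `H` on `Ω` such that the
Wronskian `W(l¹, …, l^p)`, by which the Darboux operator divides, does not vanish on `Ω`. -/
structure IsRepresentation {p : ℕ} (Ω : Set (Jet 𝕜)) (L : Jet 𝕜 → 𝕜)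
    (l : Fin p → Jet 𝕜 → 𝕜) (H : Jet 𝕜 → 𝕜) : Prop where
  diff_L : IsDifferentialFunction Ω L
  diff_l : ∀ s, IsDifferentialFunction Ω (l s)
  diff_H : IsDifferentialFunction Ω H
  wronskian_ne_zero : ∀ z ∈ Ω, wronskian l z ≠ 0
  eq : ∀ z ∈ Ω, L z = darbouxAdjoint l H z

/-- A point transformation `t̃ = T(t,u)`, `ũ = U(t,u)`: a smooth diffeomorphism between two open
subsets of the plane of the variables `(t,u)`. -/
structure PointTransformation (𝕜 : Type*) [RCLike 𝕜] where
  /-- the underlying homeomorphism of open sets -/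
  toHomeo : OpenPartialHomeomorph (𝕜 × 𝕜) (𝕜 × 𝕜)
  smooth : ContDiffOn 𝕜 ∞ toHomeo toHomeo.source
  smooth_symm : ContDiffOn 𝕜 ∞ toHomeo.symm toHomeo.target

namespace PointTransformation

/-- The component `T`, as a function on the jet space. -/
def T (τ : PointTransformation 𝕜) (z : Jet 𝕜) : 𝕜 := (τ.toHomeo (z.1, z.2 0)).1

/-- The component `U`, as a function on the jet space. -/
def U (τ : PointTransformation 𝕜) (z : Jet 𝕜) : 𝕜 := (τ.toHomeo (z.1, z.2 0)).2

/-- The `k`-th transformed derivative `ũ_k` as a function on the jet space of the original variables: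
`ũ₀ = U` and `ũ_{k+1} = D_t ũ_k / D_t T`. -/
def transformedDeriv (τ : PointTransformation 𝕜) : ℕ → Jet 𝕜 → 𝕜
  | 0 => τ.U
  | k + 1 => fun z => totalDeriv (transformedDeriv τ k) z / totalDeriv τ.T z

/-- The prolongation of the point transformation to the infinite jet space. -/
def prolong (τ : PointTransformation 𝕜) (z : Jet 𝕜) : Jet 𝕜 :=
  (τ.T z, fun k => τ.transformedDeriv k z)

/-- The part of the jet space where the prolongation is defined: `(t,u)` lies in the domain of the
point transformation and `D_t T ≠ 0`. -/
def prolongDomain (τ : PointTransformation 𝕜) : Set (Jet 𝕜) :=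
  {z | (z.1, z.2 0) ∈ τ.toHomeo.source ∧ totalDeriv τ.T z ≠ 0}

end PointTransformation

end InverseCL

end

namespace InverseCL

noncomputable section

section DifferentialAlgebra

variable {R : Type*} [CommRing R]

/-- Multiplication by `f`, as an additive endomorphism. -/
abbrev mulEnd (f : R) : Module.End ℤ R := LinearMap.mulLeft ℤ f

/-- A derivation, as an additive endomorphism. -/
abbrev derivEnd (D : Derivation ℤ R R) : Module.End ℤ R := D

/-- The pair of the operator `∑ a_i D^i` and its formal adjoint `∑ (-D)^i a_i`. -/
def adjointPair (D : Derivation ℤ R R) : (ℕ →₀ R) →+ Module.End ℤ R × Module.End ℤ R :=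
  Finsupp.liftAddHom fun i =>
    { toFun := fun r => (mulEnd r * derivEnd D ^ i, (-derivEnd D) ^ i * mulEnd r)
      map_zero' := by ext <;> simp
      map_add' := fun r s => by ext <;> simp [add_mul] }

theorem adjointPair_single (D : Derivation ℤ R R) (i : ℕ) (r : R) :
    adjointPair D (Finsupp.single i r) =
      (mulEnd r * derivEnd D ^ i, (-derivEnd D) ^ i * mulEnd r) := by
  simp [adjointPair]

theorem derivEnd_pow_apply (D : Derivation ℤ R R) (i : ℕ) (x : R) :
    (derivEnd D ^ i) x = D^[i] x := by
  rw [Module.End.pow_apply]; rfl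

theorem neg_derivEnd_pow_apply (D : Derivation ℤ R R) (i : ℕ) (x : R) :
    ((-derivEnd D) ^ i) x = (-1) ^ i * D^[i] x := by
  rw [neg_pow, Module.End.mul_apply, derivEnd_pow_apply]
  rcases Nat.even_or_odd i with h | h <;> simp [h.neg_one_pow]

/-- `Ψ` is the formal adjoint of the differential operator `Φ` with respect to `D`. -/
def IsFormalAdjoint (D : Derivation ℤ R R) (Φ Ψ : Module.End ℤ R) : Prop :=
  (Φ, Ψ) ∈ (adjointPair D).range

namespace IsFormalAdjoint

variable {D : Derivation ℤ R R} {Φ Ψ Φ₁ Ψ₁ Φ₂ Ψ₂ : Module.End ℤ R}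

theorem zero : IsFormalAdjoint D 0 0 := (adjointPair D).range.zero_mem

theorem add (h₁ : IsFormalAdjoint D Φ₁ Ψ₁) (h₂ : IsFormalAdjoint D Φ₂ Ψ₂) :
    IsFormalAdjoint D (Φ₁ + Φ₂) (Ψ₁ + Ψ₂) :=
  (adjointPair D).range.add_mem h₁ h₂

theorem mk_single (i : ℕ) (r : R) :
    IsFormalAdjoint D (mulEnd r * derivEnd D ^ i) ((-derivEnd D) ^ i * mulEnd r) :=
  ⟨Finsupp.single i r, adjointPair_single D i r⟩

theorem one : IsFormalAdjoint D 1 1 := by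
  have h := mk_single (D := D) 0 1
  have e : mulEnd (1 : R) = 1 := by ext x; simp
  rwa [pow_zero, pow_zero, e, mul_one] at h

/-- A property of pairs of operators that is additive and holds for monomials holds for all pairs
of formally adjoint operators. -/
theorem induction {P : Module.End ℤ R → Module.End ℤ R → Prop} (h0 : P 0 0)
    (hadd : ∀ Φ₁ Ψ₁ Φ₂ Ψ₂, P Φ₁ Ψ₁ → P Φ₂ Ψ₂ → P (Φ₁ + Φ₂) (Ψ₁ + Ψ₂))
    (hsingle : ∀ i r, P (mulEnd r * derivEnd D ^ i) ((-derivEnd D) ^ i * mulEnd r))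
    (h : IsFormalAdjoint D Φ Ψ) : P Φ Ψ := by
  obtain ⟨a, ha⟩ := h
  have key : ∀ a, P (adjointPair D a).1 (adjointPair D a).2 := by
    intro a
    induction a using Finsupp.induction_linear with
    | zero => simpa using h0
    | add f g hf hg => rw [map_add]; exact hadd _ _ _ _ hf hg
    | single i r => rw [adjointPair_single]; exact hsingle i r
  have := key a
  rwa [ha] at this

theorem mul_left (f : R) (h : IsFormalAdjoint D Φ Ψ) :
    IsFormalAdjoint D (mulEnd f * Φ) (Ψ * mulEnd f) := by
  refine induction (P := fun Φ Ψ => IsFormalAdjoint D (mulEnd f * Φ) (Ψ * mulEnd f))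
    ?_ ?_ ?_ h
  · simpa using zero
  · intro _ _ _ _ h₁ h₂
    rw [mul_add, add_mul]
    exact h₁.add h₂
  · intro i r
    have e : mulEnd f * mulEnd r = mulEnd (f * r) := by ext; simp
    have e' : mulEnd r * mulEnd f = mulEnd (f * r) := by ext; simp; ring
    rw [← mul_assoc, e, mul_assoc, e']
    exact mk_single i _

theorem deriv_left (h : IsFormalAdjoint D Φ Ψ) :
    IsFormalAdjoint D (derivEnd D * Φ) (Ψ * -derivEnd D) := by
  refine induction (P := fun Φ Ψ => IsFormalAdjoint D (derivEnd D * Φ) (Ψ * -derivEnd D))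
    ?_ ?_ ?_ h
  · simpa using zero
  · intro _ _ _ _ h₁ h₂
    rw [mul_add, add_mul]
    exact h₁.add h₂
  · intro i r
    have h := (mk_single (D := D) i (D r)).add (mk_single (D := D) (i + 1) r)
    convert h using 1
    · have e : derivEnd D * mulEnd r = mulEnd (D r) + mulEnd r * derivEnd D := by
        ext x; simp; ring
      rw [← mul_assoc, e, add_mul, pow_succ', mul_assoc]
    · have e : mulEnd r * -derivEnd D = mulEnd (D r) + -derivEnd D * mulEnd r := by
        ext x; simp; ring
      rw [mul_assoc, e, mul_add, pow_succ, mul_assoc]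

theorem deriv_pow_left (h : IsFormalAdjoint D Φ Ψ) (i : ℕ) :
    IsFormalAdjoint D (derivEnd D ^ i * Φ) (Ψ * (-derivEnd D) ^ i) := by
  induction i with
  | zero => simpa using h
  | succ i ih =>
    rw [pow_succ', mul_assoc, pow_succ, ← mul_assoc]
    exact ih.deriv_left

/-- The adjoint of a composition is the composition of the adjoints in the reverse order. -/
theorem mul (h₁ : IsFormalAdjoint D Φ₁ Ψ₁) (h₂ : IsFormalAdjoint D Φ₂ Ψ₂) :
    IsFormalAdjoint D (Φ₁ * Φ₂) (Ψ₂ * Ψ₁) := by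
  refine induction (P := fun Φ Ψ => IsFormalAdjoint D (Φ * Φ₂) (Ψ₂ * Ψ)) ?_ ?_ ?_ h₁
  · simpa using zero
  · intro _ _ _ _ h h'
    rw [mul_add, add_mul]
    exact h.add h'
  · intro i r
    rw [mul_assoc, ← mul_assoc Ψ₂]
    exact (h₂.deriv_pow_left i).mul_left r

theorem mulEnd_self (f : R) : IsFormalAdjoint D (mulEnd f) (mulEnd f) := by
  simpa using one.mul_left (D := D) f

theorem sum {ι : Type*} (s : Finset ι) {Φ Ψ : ι → Module.End ℤ R}
    (h : ∀ i ∈ s, IsFormalAdjoint D (Φ i) (Ψ i)) :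
    IsFormalAdjoint D (∑ i ∈ s, Φ i) (∑ i ∈ s, Ψ i) := by
  have := (adjointPair D).range.sum_mem (t := s) (f := fun i => (Φ i, Ψ i)) h
  rwa [show ∑ i ∈ s, (Φ i, Ψ i) = (∑ i ∈ s, Φ i, ∑ i ∈ s, Ψ i) from
    Prod.ext Prod.fst_sum Prod.snd_sum] at this

/-- If `D = J A` then the formal adjoint with respect to `A` is obtained from the one with respect
to `D` by conjugation with `J`. -/
theorem change_derivation {A : Derivation ℤ R R} (J : Rˣ) (hJ : ∀ x, D x = J * A x)
    (h : IsFormalAdjoint D Φ Ψ) :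
    IsFormalAdjoint A Φ (mulEnd ((J⁻¹ : Rˣ) : R) * Ψ * mulEnd (J : R)) := by
  have e : derivEnd D = mulEnd (J : R) * derivEnd A := by ext x; simp [hJ]
  have i1 : mulEnd ((J⁻¹ : Rˣ) : R) * mulEnd (J : R) = 1 := by ext x; simp
  have i2 : mulEnd (J : R) * mulEnd ((J⁻¹ : Rˣ) : R) = 1 := by ext x; simp
  have hD : ∀ i : ℕ, IsFormalAdjoint A (derivEnd D ^ i)
      (mulEnd ((J⁻¹ : Rˣ) : R) * (-derivEnd D) ^ i * mulEnd (J : R)) := by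
    intro i
    induction i with
    | zero => simpa [i1] using one (D := A)
    | succ i ih =>
      have := ih.deriv_left.mul_left (J : R)
      rw [← mul_assoc, ← e, ← pow_succ'] at this
      convert this using 1
      rw [pow_succ, e]
      noncomm_ring
  refine induction (P := fun Φ Ψ => IsFormalAdjoint A Φ
    (mulEnd ((J⁻¹ : Rˣ) : R) * Ψ * mulEnd (J : R))) ?_ ?_ ?_ h
  · simpa using zero (D := A)
  · intro _ _ _ _ h h'
    rw [mul_add, add_mul]
    exact h.add h'
  · intro i r
    have := (hD i).mul_left r
    convert this using 1
    have c : mulEnd r * mulEnd (J : R) = mulEnd (J : R) * mulEnd r := by ext x; simp; ring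
    rw [mul_assoc, mul_assoc, c, mul_assoc, mul_assoc]

end IsFormalAdjoint

theorem iterate_derivation_pow (D : Derivation ℤ R R) {t : R} (ht : D t = 1) (i j : ℕ) :
    D^[i] (t ^ j) = (j.descFactorial i : R) * t ^ (j - i) := by
  induction i with
  | zero => simp
  | succ i ih =>
    rw [Function.iterate_succ_apply', ih, Derivation.leibniz, Derivation.leibniz_pow, ht,
      Nat.descFactorial_succ, Derivation.map_natCast, Nat.sub_sub]
    simp
    ring

/-- A differential operator is determined by its action when `D t = 1` for some `t`. -/
theorem adjointPair_eq_zero (D : Derivation ℤ R R) {t : R} (ht : D t = 1)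
    (htf : ∀ (n : ℕ) (r : R), n ≠ 0 → (n : R) * r = 0 → r = 0) (a : ℕ →₀ R)
    (ha : (adjointPair D a).1 = 0) : a = 0 := by
  have key : ∀ x, (adjointPair D a).1 x = a.sum fun i r => r * D^[i] x := by
    intro x
    clear ha
    induction a using Finsupp.induction_linear with
    | zero => simp
    | add f g hf hg =>
      rw [map_add, Prod.fst_add, LinearMap.add_apply, hf, hg,
        Finsupp.sum_add_index' (by simp) (by intros; ring)]
    | single i r =>
      rw [adjointPair_single, Finsupp.sum_single_index (by simp), Module.End.mul_apply,
        derivEnd_pow_apply]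
      rfl
  ext j
  induction j using Nat.strong_induction_on with
  | _ j ih =>
    have h : (adjointPair D a).1 (t ^ j) = 0 := by rw [ha]; rfl
    rw [key, Finsupp.sum, Finset.sum_eq_single j] at h
    · rw [iterate_derivation_pow D ht, Nat.descFactorial_self, Nat.sub_self, pow_zero, mul_one,
        mul_comm] at h
      exact htf _ _ (Nat.factorial_ne_zero j) h
    · intro i _ hij
      rcases lt_or_gt_of_ne hij with hlt | hgt
      · rw [ih i hlt]; simp
      · rw [iterate_derivation_pow D ht, Nat.descFactorial_of_lt hgt]; simp
    · intro hj
      rw [Finsupp.notMem_support_iff.mp hj, zero_mul]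

/-- The formal adjoint is determined by the action of the operator. -/
theorem IsFormalAdjoint.unique {D : Derivation ℤ R R} {t : R} (ht : D t = 1)
    (htf : ∀ (n : ℕ) (r : R), n ≠ 0 → (n : R) * r = 0 → r = 0) {Φ Ψ₁ Ψ₂ : Module.End ℤ R}
    (h₁ : IsFormalAdjoint D Φ Ψ₁) (h₂ : IsFormalAdjoint D Φ Ψ₂) : Ψ₁ = Ψ₂ := by
  obtain ⟨a, ha⟩ := h₁
  obtain ⟨b, hb⟩ := h₂
  have : a - b = 0 := adjointPair_eq_zero D ht htf _ (by rw [map_sub, ha, hb]; simp)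
  rw [sub_eq_zero.mp this, hb] at ha
  exact (Prod.ext_iff.mp ha).2.symm

/-- The Wronskian with respect to a derivation. -/
def algWronskian (D : Derivation ℤ R R) {k : ℕ} (f : Fin k → R) : R :=
  Matrix.det (Matrix.of fun l l' : Fin k => D^[(l' : ℕ)] (f l))

/-- The coefficients of the Darboux operator with respect to a derivation. -/
def algDarbouxCoeff (D : Derivation ℤ R R) {k : ℕ} (f : Fin k → R) (w : Rˣ) (i : Fin (k + 1)) : R :=
  (-1) ^ (k + (i : ℕ)) * Matrix.det (Matrix.of fun l j : Fin k => D^[(i.succAbove j : ℕ)] (f l)) *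
    ((w⁻¹ : Rˣ) : R)

/-- The Darboux operator with respect to a derivation. -/
def algDarboux (D : Derivation ℤ R R) {k : ℕ} (f : Fin k → R) (w : Rˣ) : Module.End ℤ R :=
  ∑ i : Fin (k + 1), mulEnd (algDarbouxCoeff D f w i) * derivEnd D ^ (i : ℕ)

/-- The formal adjoint of the Darboux operator with respect to a derivation. -/
def algDarbouxAdjoint (D : Derivation ℤ R R) {k : ℕ} (f : Fin k → R) (w : Rˣ) : Module.End ℤ R :=
  ∑ i : Fin (k + 1), (-derivEnd D) ^ (i : ℕ) * mulEnd (algDarbouxCoeff D f w i)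

theorem isFormalAdjoint_algDarboux (D : Derivation ℤ R R) {k : ℕ} (f : Fin k → R) (w : Rˣ) :
    IsFormalAdjoint D (algDarboux D f w) (algDarbouxAdjoint D f w) :=
  IsFormalAdjoint.sum _ fun _ _ => IsFormalAdjoint.mk_single _ _

theorem algDarboux_apply (D : Derivation ℤ R R) {k : ℕ} (f : Fin k → R) (w : Rˣ) (G : R) :
    algDarboux D f w G =
      algWronskian D (Fin.snoc f G : Fin (k + 1) → R) * ((w⁻¹ : Rˣ) : R) := by
  conv_rhs => rw [algWronskian, Matrix.det_succ_row _ (Fin.last k)]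
  rw [Finset.sum_mul, algDarboux, LinearMap.sum_apply]
  refine Finset.sum_congr rfl fun i _ => ?_
  have h : (Matrix.of fun l l' : Fin (k + 1) =>
        (D^[(l' : ℕ)] ((Fin.snoc f G : Fin (k + 1) → R) l))).submatrix
          (Fin.last k).succAbove i.succAbove =
      Matrix.of fun l j : Fin k => D^[(i.succAbove j : ℕ)] (f l) := by
    ext l j
    simp
  rw [h, Module.End.mul_apply, derivEnd_pow_apply]
  simp only [algDarbouxCoeff, Matrix.of_apply, Fin.snoc_last, Fin.val_last,
    LinearMap.mulLeft_apply]
  ring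

/-- Expansion of `A^j (c⁻¹ x)` in powers of `D`, where `D = J A`. -/
theorem exists_iterate_expansion {D A : Derivation ℤ R R} (J c : Rˣ) (hJ : ∀ x, D x = J * A x)
    (j : ℕ) :
    ∃ m : ℕ → R, m j = ((c⁻¹ * J⁻¹ ^ j : Rˣ) : R) ∧ (∀ i, j < i → m i = 0) ∧
      ∀ (x : R) (N : ℕ), j < N →
        A^[j] (((c⁻¹ : Rˣ) : R) * x) = ∑ i ∈ Finset.range N, m i * D^[i] x := by
  have hA : ∀ x, A x = ((J⁻¹ : Rˣ) : R) * D x := fun x => by simp [hJ]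
  induction j with
  | zero =>
    refine ⟨fun i => if i = 0 then ((c⁻¹ : Rˣ) : R) else 0, by simp, fun i hi => by simp [hi.ne'],
      fun x N hN => ?_⟩
    rw [Finset.sum_eq_single 0 (by intro i _ hi; simp [hi]) (by simp; omega)]
    simp
  | succ j ih =>
    obtain ⟨m, h1, h2, h3⟩ := ih
    refine ⟨fun i => ((J⁻¹ : Rˣ) : R) * (D (m i) + if i = 0 then 0 else m (i - 1)), ?_, ?_, ?_⟩
    · simp only [h2 (j + 1) (by omega), map_zero, Nat.add_sub_cancel, h1]
      simp [pow_succ]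
      ring
    · intro i hi
      have h0 : i ≠ 0 := by omega
      simp [h0, h2 i (by omega), h2 (i - 1) (by omega)]
    · intro x N hN
      obtain ⟨M, rfl⟩ : ∃ M, N = M + 1 := ⟨N - 1, by omega⟩
      rw [Function.iterate_succ_apply', h3 x M (by omega), hA, map_sum]
      have e1 : ∑ i ∈ Finset.range M, D (m i * D^[i] x) =
          ∑ i ∈ Finset.range M, D (m i) * D^[i] x +
            ∑ i ∈ Finset.range M, m i * D^[i + 1] x := by
        rw [← Finset.sum_add_distrib]
        refine Finset.sum_congr rfl fun i _ => ?_
        rw [Derivation.leibniz, Function.iterate_succ_apply']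
        simp
        ring
      have e2 : ∑ i ∈ Finset.range M, m i * D^[i + 1] x =
          ∑ i ∈ Finset.range (M + 1), (if i = 0 then 0 else m (i - 1)) * D^[i] x := by
        rw [Finset.sum_range_succ']
        simp
      have e3 : ∑ i ∈ Finset.range M, D (m i) * D^[i] x =
          ∑ i ∈ Finset.range (M + 1), D (m i) * D^[i] x := by
        rw [Finset.sum_range_succ, h2 M (by omega)]
        simp
      rw [e1, e2, e3, ← Finset.sum_add_distrib, Finset.mul_sum]
      refine Finset.sum_congr rfl fun i _ => ?_
      ring

/-- The transformation rule of Wronskians under `D = J A` and division of the functions by `c`. -/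
theorem algWronskian_change {D A : Derivation ℤ R R} (J c : Rˣ) (hJ : ∀ x, D x = J * A x)
    {k : ℕ} (f : Fin k → R) :
    algWronskian A (fun s => ((c⁻¹ : Rˣ) : R) * f s) =
      ((∏ j : Fin k, c⁻¹ * J⁻¹ ^ (j : ℕ) : Rˣ) : R) * algWronskian D f := by
  choose m h1 h2 h3 using exists_iterate_expansion (D := D) (A := A) J c hJ
  have e : (Matrix.of fun l l' : Fin k => A^[(l' : ℕ)] (((c⁻¹ : Rˣ) : R) * f l)) =
      (Matrix.of fun l l' : Fin k => D^[(l' : ℕ)] (f l)) *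
        (Matrix.of fun i j : Fin k => m j i) := by
    ext l j
    rw [Matrix.mul_apply]
    simp only [Matrix.of_apply]
    rw [h3 j (f l) k j.2, Finset.sum_range]
    exact Finset.sum_congr rfl fun i _ => mul_comm _ _
  rw [algWronskian, e, Matrix.det_mul, mul_comm, algWronskian,
    Matrix.det_of_isUpperTriangular (M := Matrix.of fun i j : Fin k => m j i)
      (fun i j hij => h2 j i hij)]
  simp only [Matrix.of_apply, h1]
  rw [Units.coe_prod]

/-- The transformation rule of adjoint Darboux operators under `D = J A`. -/
theorem algDarbouxAdjoint_change {D A : Derivation ℤ R R} (J Λ : Rˣ)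
    (hJ : ∀ x, D x = J * A x) {t : R} (ht : A t = 1)
    (htf : ∀ (n : ℕ) (r : R), n ≠ 0 → (n : R) * r = 0 → r = 0)
    {p : ℕ} (l l' : Fin p → R) (hl : ∀ s, l' s = (((Λ * J)⁻¹ : Rˣ) : R) * l s) (w w' : Rˣ)
    (hw : (w : R) = algWronskian D l) (hw' : (w' : R) = algWronskian A l') (H : R) :
    algDarbouxAdjoint A l' w' (Λ * J ^ p * H) = Λ * algDarbouxAdjoint D l w H := by
  set c : Rˣ := Λ * J with hc
  obtain rfl : l' = fun s => ((c⁻¹ : Rˣ) : R) * l s := funext hl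
  rw [algWronskian_change J c hJ, ← hw, ← Units.val_mul, Units.val_inj] at hw'
  have hop : algDarboux A (fun s => ((c⁻¹ : Rˣ) : R) * l s) w' =
      mulEnd ((c⁻¹ * J⁻¹ ^ p : Rˣ) : R) * (algDarboux D l w * mulEnd (c : R)) := by
    ext G
    have hs : (Fin.snoc (fun s => ((c⁻¹ : Rˣ) : R) * l s) G : Fin (p + 1) → R) =
        fun s => ((c⁻¹ : Rˣ) : R) * (Fin.snoc l ((c : R) * G) : Fin (p + 1) → R) s := by
      ext s
      refine Fin.lastCases ?_ (fun s => ?_) s <;> simp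
    rw [Module.End.mul_apply, Module.End.mul_apply, algDarboux_apply, algDarboux_apply, hs,
      algWronskian_change J c hJ, Fin.prod_univ_castSucc, hw']
    simp only [LinearMap.mulLeft_apply, Fin.val_castSucc, Fin.val_last, mul_inv, Units.val_mul]
    have hu : ((∏ j : Fin p, c⁻¹ * J⁻¹ ^ (j : ℕ) : Rˣ) : R) *
        (((∏ j : Fin p, c⁻¹ * J⁻¹ ^ (j : ℕ))⁻¹ : Rˣ) : R) = 1 := Units.mul_inv _
    linear_combination ((c⁻¹ : Rˣ) : R) * ((J⁻¹ ^ p : Rˣ) : R) *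
      algWronskian D (Fin.snoc l ((c : R) * G) : Fin (p + 1) → R) * ((w⁻¹ : Rˣ) : R) * hu
  have h1 := (IsFormalAdjoint.mulEnd_self (D := D) ((c⁻¹ * J⁻¹ ^ p : Rˣ) : R)).mul
    ((isFormalAdjoint_algDarboux D l w).mul (IsFormalAdjoint.mulEnd_self (c : R)))
  rw [← hop] at h1
  have h2 := (isFormalAdjoint_algDarboux A (fun s => ((c⁻¹ : Rˣ) : R) * l s) w').unique ht htf
    (h1.change_derivation J hJ)
  rw [h2]
  simp only [Module.End.mul_apply, LinearMap.mulLeft_apply]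
  have e1 : ((c⁻¹ * J⁻¹ ^ p : Rˣ) : R) * ((J : R) * (Λ * J ^ p * H)) = H := by
    have : (c⁻¹ * J⁻¹ ^ p) * (J * (Λ * J ^ p)) = 1 := by
      rw [hc, ← mul_assoc J, mul_comm J, inv_pow, ← mul_inv, inv_mul_cancel]
    have := congrArg (Units.val) this
    push_cast at this ⊢
    linear_combination H * this
  have e2 : ((J⁻¹ : Rˣ) : R) * (c : R) = Λ := by
    rw [← Units.val_mul, hc, mul_comm, mul_inv_cancel_right]
  rw [e1, ← mul_assoc, e2]

end DifferentialAlgebra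

section DifferentialFunctions

variable {𝕜 : Type*} [RCLike 𝕜]

/-- `f` factors on `Ω` through a smooth function on the jet space of order `n`. -/
def HasOrder (Ω : Set (Jet 𝕜)) (n : ℕ) (f : Jet 𝕜 → 𝕜) : Prop :=
  ∃ g : 𝕜 × (Fin (n + 1) → 𝕜) → 𝕜,
    ContDiffOn 𝕜 ∞ g (truncate n '' Ω) ∧ ∀ z ∈ Ω, f z = g (truncate n z)

/-- The projection between jet spaces of finite orders. -/
def restrictOrder {n m : ℕ} (h : n ≤ m) (y : 𝕜 × (Fin (m + 1) → 𝕜)) : 𝕜 × (Fin (n + 1) → 𝕜) :=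
  (y.1, fun i => y.2 (Fin.castLE (by omega) i))

theorem contDiff_restrictOrder {n m : ℕ} (h : n ≤ m) :
    ContDiff 𝕜 ∞ (restrictOrder (𝕜 := 𝕜) h) := by
  unfold restrictOrder
  fun_prop

theorem HasOrder.mono {Ω : Set (Jet 𝕜)} {n m : ℕ} {f : Jet 𝕜 → 𝕜} (hf : HasOrder Ω n f)
    (h : n ≤ m) : HasOrder Ω m f := by
  obtain ⟨g, hg, hfg⟩ := hf
  refine ⟨g ∘ restrictOrder h, hg.comp (contDiff_restrictOrder h).contDiffOn ?_, hfg⟩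
  rintro _ ⟨z, hz, rfl⟩
  exact ⟨z, hz, rfl⟩

theorem IsDifferentialFunction.mono {Ω Ω' : Set (Jet 𝕜)} {f : Jet 𝕜 → 𝕜}
    (hf : IsDifferentialFunction Ω f) (h : Ω' ⊆ Ω) : IsDifferentialFunction Ω' f := by
  obtain ⟨n, g, hg, hfg⟩ := hf
  exact ⟨n, g, hg.mono (Set.image_mono h), fun z hz => hfg z (h hz)⟩

theorem IsDifferentialFunction.congr {Ω : Set (Jet 𝕜)} {f f' : Jet 𝕜 → 𝕜}
    (hf : IsDifferentialFunction Ω f) (h : ∀ z ∈ Ω, f' z = f z) : IsDifferentialFunction Ω f' := by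
  obtain ⟨n, g, hg, hfg⟩ := hf
  exact ⟨n, g, hg, fun z hz => (h z hz).trans (hfg z hz)⟩

theorem continuous_truncate (n : ℕ) : Continuous (truncate (𝕜 := 𝕜) n) := by
  unfold truncate
  fun_prop

theorem isOpen_image_truncate {Ω : Set (Jet 𝕜)} (hΩ : IsOpen Ω) (n : ℕ) :
    IsOpen (truncate n '' Ω) := by
  rw [isOpen_iff_mem_nhds]
  rintro _ ⟨z, hz, rfl⟩
  let σ : 𝕜 × (Fin (n + 1) → 𝕜) → Jet 𝕜 := fun y =>
    (y.1, fun k => if h : k < n + 1 then y.2 ⟨k, h⟩ else z.2 k)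
  have hσ : Continuous σ := by
    refine continuous_fst.prodMk (continuous_pi fun k => ?_)
    by_cases h : k < n + 1
    · simp only [h, dite_true]; fun_prop
    · simp only [h, dite_false]; fun_prop
  have hσz : σ (truncate n z) = z := by
    refine Prod.ext rfl (funext fun k => ?_)
    by_cases h : k < n + 1 <;> simp [σ, truncate, h]
  have hσt : ∀ y, truncate n (σ y) = y := fun y =>
    Prod.ext rfl (funext fun i => dif_pos i.2)
  refine Filter.mem_of_superset (hσ.continuousAt.preimage_mem_nhds
    (by rw [hσz]; exact hΩ.mem_nhds hz)) fun y hy => ⟨σ y, hy, hσt y⟩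

theorem IsDifferentialFunction.continuousOn {Ω : Set (Jet 𝕜)} {f : Jet 𝕜 → 𝕜}
    (hf : IsDifferentialFunction Ω f) : ContinuousOn f Ω := by
  obtain ⟨n, g, hg, hfg⟩ := hf
  exact (hg.continuousOn.comp (continuous_truncate n).continuousOn
    (Set.mapsTo_image _ _)).congr hfg

/-- The projection to the jet space of order `n` of the direction of the total derivative. -/
def contactDir (n : ℕ) (z : Jet 𝕜) : 𝕜 × (Fin (n + 1) → 𝕜) := (1, fun i => z.2 (i + 1))

/-- The line through `z` in the direction of the total derivative. -/
def contactLine (z : Jet 𝕜) (s : 𝕜) : Jet 𝕜 := (z.1 + s, fun k => z.2 k + s * z.2 (k + 1))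

theorem contactLine_zero (z : Jet 𝕜) : contactLine z 0 = z := by
  simp [contactLine]

theorem continuous_contactLine (z : Jet 𝕜) : Continuous (contactLine z) := by
  unfold contactLine
  fun_prop

theorem hasDerivAt_truncate_contactLine (n : ℕ) (z : Jet 𝕜) :
    HasDerivAt (fun s => truncate n (contactLine z s)) (contactDir n z) 0 := by
  unfold truncate contactLine contactDir
  refine HasDerivAt.prodMk ?_ (hasDerivAt_pi.mpr fun i => ?_)
  · simpa using (hasDerivAt_id (0 : 𝕜)).const_add z.1
  · simpa using ((hasDerivAt_id (0 : 𝕜)).mul_const (z.2 (i + 1))).const_add (z.2 i)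

theorem eventually_contactLine_mem {Ω : Set (Jet 𝕜)} (hΩ : IsOpen Ω) {z : Jet 𝕜} (hz : z ∈ Ω) :
    ∀ᶠ s in 𝓝 (0 : 𝕜), contactLine z s ∈ Ω :=
  (continuous_contactLine z).continuousAt.preimage_mem_nhds
    (by rw [contactLine_zero]; exact hΩ.mem_nhds hz)

/-- The total derivative as a directional derivative in a finite-dimensional jet space. -/
theorem totalDeriv_eq_fderiv {Ω : Set (Jet 𝕜)} (hΩ : IsOpen Ω) {n : ℕ} {f : Jet 𝕜 → 𝕜}
    {g : 𝕜 × (Fin (n + 1) → 𝕜) → 𝕜} (hfg : ∀ z ∈ Ω, f z = g (truncate n z)) {z : Jet 𝕜}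
    (hz : z ∈ Ω) (hg : DifferentiableAt 𝕜 g (truncate n z)) :
    totalDeriv f z = fderiv 𝕜 g (truncate n z) (contactDir n z) := by
  have hgd := hg.hasFDerivAt
  have hT : partialT f z = fderiv 𝕜 g (truncate n z) (1, 0) := by
    have h1 : HasDerivAt (fun s : 𝕜 => truncate n ((s, z.2) : Jet 𝕜))
        ((1, 0) : 𝕜 × (Fin (n + 1) → 𝕜)) z.1 := by
      unfold truncate
      exact (hasDerivAt_id z.1).prodMk (hasDerivAt_const z.1 fun i : Fin (n + 1) => z.2 i)
    have h2 := HasFDerivAt.comp_hasDerivAt (f := fun s : 𝕜 => truncate n ((s, z.2) : Jet 𝕜))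
      z.1 hgd h1
    refine (h2.congr_of_eventuallyEq ?_).deriv
    have hc : Continuous fun s : 𝕜 => ((s, z.2) : Jet 𝕜) := by fun_prop
    filter_upwards [hc.continuousAt.preimage_mem_nhds (hΩ.mem_nhds (x := (z.1, z.2)) hz)] with s hs
    exact hfg _ hs
  have hc : ∀ k : ℕ, Continuous fun s : 𝕜 => ((z.1, Function.update z.2 k s) : Jet 𝕜) := by
    intro k
    exact continuous_const.prodMk (continuous_const.update k continuous_id)
  have hev : ∀ k : ℕ, ∀ᶠ s in 𝓝 (z.2 k), ((z.1, Function.update z.2 k s) : Jet 𝕜) ∈ Ω := by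
    intro k
    refine (hc k).continuousAt.preimage_mem_nhds (hΩ.mem_nhds ?_)
    rw [Function.update_eq_self]
    exact hz
  have hU : ∀ k : Fin (n + 1),
      partialU k f z = fderiv 𝕜 g (truncate n z) (0, Pi.single k 1) := by
    intro k
    have h1 : HasDerivAt (fun s : 𝕜 => truncate n ((z.1, Function.update z.2 k s) : Jet 𝕜))
        ((0, Pi.single k 1) : 𝕜 × (Fin (n + 1) → 𝕜)) (z.2 k) := by
      unfold truncate
      refine (hasDerivAt_const _ _).prodMk (hasDerivAt_pi.mpr fun i => ?_)
      by_cases h : i = k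
      · subst h
        simp only [Function.update_self, Pi.single_eq_same]
        exact hasDerivAt_id' _
      · have h' : (i : ℕ) ≠ k := fun e => h (Fin.ext e)
        simpa [h, h'] using hasDerivAt_const (z.2 k) (z.2 i)
    have hgd' : HasFDerivAt g (fderiv 𝕜 g (truncate n z))
        (truncate n ((z.1, Function.update z.2 k (z.2 k)) : Jet 𝕜)) := by
      rw [Function.update_eq_self]
      exact hgd
    have h2 := HasFDerivAt.comp_hasDerivAt
      (f := fun s : 𝕜 => truncate n ((z.1, Function.update z.2 k s) : Jet 𝕜)) (z.2 k) hgd' h1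
    refine (h2.congr_of_eventuallyEq ?_).deriv
    filter_upwards [hev k] with s hs
    exact hfg _ hs
  have hU0 : ∀ k : ℕ, n < k → partialU k f z = 0 := by
    intro k hk
    have h1 : HasDerivAt (fun _ : 𝕜 => g (truncate n z)) 0 (z.2 k) := hasDerivAt_const _ _
    refine (h1.congr_of_eventuallyEq ?_).deriv
    filter_upwards [hev k] with s hs
    rw [hfg _ hs]
    congr 1
    refine Prod.ext rfl (funext fun i => ?_)
    have : (i : ℕ) ≠ k := by omega
    simp [truncate, this]
  rw [totalDeriv, hT, finsum_eq_sum_of_support_subset (s := Finset.range (n + 1)),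
    Finset.sum_range]
  · have e : contactDir n z = ((1, 0) : 𝕜 × (Fin (n + 1) → 𝕜)) +
        ∑ k : Fin (n + 1), z.2 (k + 1) • ((0, Pi.single k 1) : 𝕜 × (Fin (n + 1) → 𝕜)) := by
      refine Prod.ext ?_ (funext fun i => ?_)
      · simp [contactDir, Prod.fst_sum]
      · simp [contactDir, Prod.snd_sum, Finset.sum_apply, Pi.single_apply]
    rw [e, map_add, map_sum]
    simp only [hU, map_smul, smul_eq_mul]
  · intro k hk
    by_contra h
    simp only [Finset.coe_range, Set.mem_Iio, not_lt] at h
    exact hk (by simp [hU0 k (by omega)])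

theorem HasOrder.differentiableAt {Ω : Set (Jet 𝕜)} (hΩ : IsOpen Ω) {n : ℕ}
    {g : 𝕜 × (Fin (n + 1) → 𝕜) → 𝕜} (hg : ContDiffOn 𝕜 ∞ g (truncate n '' Ω)) {z : Jet 𝕜}
    (hz : z ∈ Ω) : DifferentiableAt 𝕜 g (truncate n z) :=
  (hg.contDiffAt ((isOpen_image_truncate hΩ n).mem_nhds ⟨z, hz, rfl⟩)).differentiableAt (by simp)

/-- The total derivative is the derivative along the line `contactLine`. -/
theorem IsDifferentialFunction.hasDerivAt {Ω : Set (Jet 𝕜)} (hΩ : IsOpen Ω) {f : Jet 𝕜 → 𝕜}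
    (hf : IsDifferentialFunction Ω f) {z : Jet 𝕜} (hz : z ∈ Ω) :
    HasDerivAt (fun s => f (contactLine z s)) (totalDeriv f z) 0 := by
  obtain ⟨n, g, hg, hfg⟩ := hf
  have hd := HasOrder.differentiableAt hΩ hg hz
  rw [totalDeriv_eq_fderiv hΩ hfg hz hd]
  have hd' : HasFDerivAt g (fderiv 𝕜 g (truncate n z)) (truncate n (contactLine z 0)) := by
    rw [contactLine_zero]; exact hd.hasFDerivAt
  refine (HasFDerivAt.comp_hasDerivAt (f := fun s => truncate n (contactLine z s)) 0 hd'
    (hasDerivAt_truncate_contactLine n z)).congr_of_eventuallyEq ?_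
  filter_upwards [eventually_contactLine_mem hΩ hz] with s hs
  exact hfg _ hs

theorem totalDeriv_congr {Ω : Set (Jet 𝕜)} (hΩ : IsOpen Ω) {f f' : Jet 𝕜 → 𝕜}
    (hf : IsDifferentialFunction Ω f) (h : ∀ z ∈ Ω, f' z = f z) {z : Jet 𝕜} (hz : z ∈ Ω) :
    totalDeriv f' z = totalDeriv f z := by
  refine ((hf.congr h).hasDerivAt hΩ hz).unique ((hf.hasDerivAt hΩ hz).congr_of_eventuallyEq ?_)
  filter_upwards [eventually_contactLine_mem hΩ hz] with s hs
  exact h _ hs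

theorem HasOrder.totalDeriv {Ω : Set (Jet 𝕜)} (hΩ : IsOpen Ω) {n : ℕ} {f : Jet 𝕜 → 𝕜}
    (hf : HasOrder Ω n f) : HasOrder Ω (n + 1) (totalDeriv f) := by
  obtain ⟨g, hg, hfg⟩ := hf
  refine ⟨fun y => fderiv 𝕜 g (restrictOrder n.le_succ y) (1, fun i : Fin (n + 1) => y.2 i.succ),
    ?_, fun z hz => ?_⟩
  · refine ContDiffOn.clm_apply ?_ ?_
    · refine (hg.fderiv_of_isOpen (m := ∞) (isOpen_image_truncate hΩ n) (by simp)).comp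
        (contDiff_restrictOrder n.le_succ).contDiffOn ?_
      rintro _ ⟨z, hz, rfl⟩
      exact ⟨z, hz, rfl⟩
    · exact ContDiff.contDiffOn (by fun_prop)
  · rw [totalDeriv_eq_fderiv hΩ hfg hz (HasOrder.differentiableAt hΩ hg hz)]
    rfl

theorem IsDifferentialFunction.totalDeriv {Ω : Set (Jet 𝕜)} (hΩ : IsOpen Ω) {f : Jet 𝕜 → 𝕜}
    (hf : IsDifferentialFunction Ω f) : IsDifferentialFunction Ω (totalDeriv f) := by
  obtain ⟨n, hn⟩ := hf
  exact ⟨n + 1, HasOrder.totalDeriv hΩ hn⟩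

theorem isDifferentialFunction_const (Ω : Set (Jet 𝕜)) (c : 𝕜) :
    IsDifferentialFunction Ω fun _ => c :=
  ⟨0, fun _ => c, contDiffOn_const, fun _ _ => rfl⟩

theorem isDifferentialFunction_time (Ω : Set (Jet 𝕜)) : IsDifferentialFunction Ω fun z => z.1 :=
  ⟨0, fun y => y.1, contDiff_fst.contDiffOn, fun _ _ => rfl⟩

theorem isDifferentialFunction_coord (Ω : Set (Jet 𝕜)) (k : ℕ) :
    IsDifferentialFunction Ω fun z => z.2 k :=
  ⟨k, fun y => y.2 (Fin.last k), ContDiff.contDiffOn (by fun_prop), fun _ _ => rfl⟩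

variable {Ω : Set (Jet 𝕜)} {f h : Jet 𝕜 → 𝕜}

theorem IsDifferentialFunction.add (hf : IsDifferentialFunction Ω f)
    (hh : IsDifferentialFunction Ω h) : IsDifferentialFunction Ω fun z => f z + h z := by
  obtain ⟨n, hn⟩ := hf
  obtain ⟨m, hm⟩ := hh
  obtain ⟨g, hg, hfg⟩ := HasOrder.mono hn (le_max_left n m)
  obtain ⟨k, hk, hhk⟩ := HasOrder.mono hm (le_max_right n m)
  exact ⟨_, fun y => g y + k y, hg.add hk, fun z hz => by
    beta_reduce; rw [hfg z hz, hhk z hz]⟩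

theorem IsDifferentialFunction.mul (hf : IsDifferentialFunction Ω f)
    (hh : IsDifferentialFunction Ω h) : IsDifferentialFunction Ω fun z => f z * h z := by
  obtain ⟨n, hn⟩ := hf
  obtain ⟨m, hm⟩ := hh
  obtain ⟨g, hg, hfg⟩ := HasOrder.mono hn (le_max_left n m)
  obtain ⟨k, hk, hhk⟩ := HasOrder.mono hm (le_max_right n m)
  exact ⟨_, fun y => g y * k y, hg.mul hk, fun z hz => by
    beta_reduce; rw [hfg z hz, hhk z hz]⟩

theorem IsDifferentialFunction.inv (hf : IsDifferentialFunction Ω f) (h0 : ∀ z ∈ Ω, f z ≠ 0) :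
    IsDifferentialFunction Ω fun z => (f z)⁻¹ := by
  obtain ⟨n, g, hg, hfg⟩ := hf
  refine ⟨n, fun y => (g y)⁻¹, hg.inv ?_, fun z hz => by
    beta_reduce; rw [hfg z hz]⟩
  rintro _ ⟨z, hz, rfl⟩
  rw [← hfg z hz]
  exact h0 z hz

theorem totalDeriv_add (hΩ : IsOpen Ω) (hf : IsDifferentialFunction Ω f)
    (hh : IsDifferentialFunction Ω h) {z : Jet 𝕜} (hz : z ∈ Ω) :
    totalDeriv (fun w => f w + h w) z = totalDeriv f z + totalDeriv h z :=
  ((hf.add hh).hasDerivAt hΩ hz).unique ((hf.hasDerivAt hΩ hz).add (hh.hasDerivAt hΩ hz))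

theorem totalDeriv_mul (hΩ : IsOpen Ω) (hf : IsDifferentialFunction Ω f)
    (hh : IsDifferentialFunction Ω h) {z : Jet 𝕜} (hz : z ∈ Ω) :
    totalDeriv (fun w => f w * h w) z = totalDeriv f z * h z + f z * totalDeriv h z := by
  have := (hf.hasDerivAt hΩ hz).mul (hh.hasDerivAt hΩ hz)
  rw [contactLine_zero] at this
  exact ((hf.mul hh).hasDerivAt hΩ hz).unique this

theorem totalDeriv_time (z : Jet 𝕜) : totalDeriv (fun w => w.1) z = 1 := by
  refine ((isDifferentialFunction_time Set.univ).hasDerivAt isOpen_univ (Set.mem_univ z)).unique ?_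
  simpa [contactLine] using (hasDerivAt_id (0 : 𝕜)).const_add z.1

theorem totalDeriv_coord (k : ℕ) (z : Jet 𝕜) : totalDeriv (fun w => w.2 k) z = z.2 (k + 1) := by
  refine ((isDifferentialFunction_coord Set.univ k).hasDerivAt isOpen_univ
    (Set.mem_univ z)).unique ?_
  simpa [contactLine] using
    ((hasDerivAt_id (0 : 𝕜)).mul_const (z.2 (k + 1))).const_add (z.2 k)

/-- A map of jet spaces whose components are differential functions. -/
structure IsDifferentialMap (Ω : Set (Jet 𝕜)) (φ : Jet 𝕜 → Jet 𝕜) : Prop where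
  time : IsDifferentialFunction Ω fun z => (φ z).1
  coord : ∀ k, IsDifferentialFunction Ω fun z => (φ z).2 k

theorem IsDifferentialMap.continuousOn {φ : Jet 𝕜 → Jet 𝕜} (hφ : IsDifferentialMap Ω φ) :
    ContinuousOn φ Ω :=
  hφ.time.continuousOn.prodMk (continuousOn_pi.mpr fun k => (hφ.coord k).continuousOn)

theorem IsDifferentialFunction.comp {V : Set (Jet 𝕜)} {G : Jet 𝕜 → 𝕜} {φ : Jet 𝕜 → Jet 𝕜}
    (hG : IsDifferentialFunction V G) (hφ : IsDifferentialMap Ω φ) (hm : Set.MapsTo φ Ω V) :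
    IsDifferentialFunction Ω fun z => G (φ z) := by
  obtain ⟨n, g, hg, hGg⟩ := hG
  obtain ⟨N₀, h0⟩ := hφ.time
  choose N hN using hφ.coord
  let M := max N₀ (Finset.univ.sup fun i : Fin (n + 1) => N i)
  obtain ⟨a, ha, ha'⟩ := HasOrder.mono h0 (le_max_left N₀ _ : N₀ ≤ M)
  have hb : ∀ i : Fin (n + 1), HasOrder Ω M fun z => (φ z).2 i := fun i =>
    HasOrder.mono (hN i) ((Finset.le_sup (f := fun i : Fin (n + 1) => N i)
      (Finset.mem_univ i)).trans (le_max_right _ _))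
  choose b hb hb' using hb
  have e : ∀ z ∈ Ω, truncate n (φ z) = (a (truncate M z), fun i => b i (truncate M z)) :=
    fun z hz => Prod.ext (ha' z hz) (funext fun i => hb' i z hz)
  refine ⟨M, fun y => g (a y, fun i => b i y), ?_, fun z hz => ?_⟩
  · refine hg.comp (ha.prodMk (contDiffOn_pi.mpr hb)) ?_
    rintro _ ⟨z, hz, rfl⟩
    exact ⟨φ z, hm hz, e z hz⟩
  · beta_reduce
    rw [hGg _ (hm hz), e z hz]

/-- The chain rule for maps of jet spaces that preserve the direction of the total derivative up to
the factor `J`. -/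
theorem totalDeriv_comp {V : Set (Jet 𝕜)} {G : Jet 𝕜 → 𝕜} {φ : Jet 𝕜 → Jet 𝕜} (hΩ : IsOpen Ω)
    (hV : IsOpen V) (hG : IsDifferentialFunction V G) (hφ : IsDifferentialMap Ω φ)
    (hm : Set.MapsTo φ Ω V) {z : Jet 𝕜} (hz : z ∈ Ω) {J : 𝕜}
    (h0 : totalDeriv (fun w => (φ w).1) z = J)
    (hk : ∀ k, totalDeriv (fun w => (φ w).2 k) z = J * (φ z).2 (k + 1)) :
    totalDeriv (fun w => G (φ w)) z = J * totalDeriv G (φ z) := by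
  refine ((hG.comp hφ hm).hasDerivAt hΩ hz).unique ?_
  obtain ⟨n, g, hg, hGg⟩ := hG
  have hd := HasOrder.differentiableAt hV hg (hm hz)
  rw [totalDeriv_eq_fderiv hV hGg (hm hz) hd]
  have h1 : HasDerivAt (fun s => truncate n (φ (contactLine z s)))
      (J • contactDir n (φ z)) 0 := by
    unfold truncate contactDir
    rw [Prod.smul_mk]
    refine HasDerivAt.prodMk ?_ (hasDerivAt_pi.mpr fun i => ?_)
    · simpa [h0] using hφ.time.hasDerivAt hΩ hz
    · simpa [hk] using (hφ.coord i).hasDerivAt hΩ hz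
  have hd' : HasFDerivAt g (fderiv 𝕜 g (truncate n (φ z))) (truncate n (φ (contactLine z 0))) := by
    rw [contactLine_zero]; exact hd.hasFDerivAt
  have h2 := HasFDerivAt.comp_hasDerivAt (f := fun s => truncate n (φ (contactLine z s))) 0 hd' h1
  rw [map_smul, smul_eq_mul] at h2
  refine h2.congr_of_eventuallyEq ?_
  filter_upwards [eventually_contactLine_mem hΩ hz] with s hs
  exact hGg _ (hm hs)

end DifferentialFunctions

namespace PointTransformation

variable {𝕜 : Type*} [RCLike 𝕜] (τ : PointTransformation 𝕜)

/-- The part of the jet space that lies over the domain of the point transformation. -/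
def baseDomain : Set (Jet 𝕜) := {z | (z.1, z.2 0) ∈ τ.toHomeo.source}

theorem isOpen_baseDomain : IsOpen τ.baseDomain :=
  τ.toHomeo.open_source.preimage (f := fun z : Jet 𝕜 => (z.1, z.2 0)) (by fun_prop)

theorem isDifferentialFunction_T : IsDifferentialFunction τ.baseDomain τ.T := by
  refine ⟨0, fun y => (τ.toHomeo (y.1, y.2 0)).1, ?_, fun _ _ => rfl⟩
  refine contDiff_fst.comp_contDiffOn (τ.smooth.comp (ContDiff.contDiffOn (by fun_prop)) ?_)
  rintro _ ⟨z, hz, rfl⟩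
  exact hz

theorem isDifferentialFunction_U : IsDifferentialFunction τ.baseDomain τ.U := by
  refine ⟨0, fun y => (τ.toHomeo (y.1, y.2 0)).2, ?_, fun _ _ => rfl⟩
  refine contDiff_snd.comp_contDiffOn (τ.smooth.comp (ContDiff.contDiffOn (by fun_prop)) ?_)
  rintro _ ⟨z, hz, rfl⟩
  exact hz

theorem prolongDomain_subset : τ.prolongDomain ⊆ τ.baseDomain := fun _ hz => hz.1

theorem isOpen_prolongDomain : IsOpen τ.prolongDomain :=
  (τ.isDifferentialFunction_T.totalDeriv τ.isOpen_baseDomain).continuousOn.isOpen_inter_preimage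
    τ.isOpen_baseDomain isOpen_compl_singleton

theorem isDifferentialFunction_totalDeriv_T :
    IsDifferentialFunction τ.prolongDomain (totalDeriv τ.T) :=
  (τ.isDifferentialFunction_T.totalDeriv τ.isOpen_baseDomain).mono τ.prolongDomain_subset

theorem isDifferentialFunction_transformedDeriv (k : ℕ) :
    IsDifferentialFunction τ.prolongDomain (τ.transformedDeriv k) := by
  induction k with
  | zero => exact τ.isDifferentialFunction_U.mono τ.prolongDomain_subset
  | succ k ih =>
    refine ((ih.totalDeriv τ.isOpen_prolongDomain).mul
      (τ.isDifferentialFunction_totalDeriv_T.inv fun z hz => hz.2)).congr fun z _ => ?_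
    exact div_eq_mul_inv _ _

theorem isDifferentialMap_prolong : IsDifferentialMap τ.prolongDomain τ.prolong :=
  ⟨τ.isDifferentialFunction_T.mono τ.prolongDomain_subset,
    τ.isDifferentialFunction_transformedDeriv⟩

/-- The chain rule `D_t (G ∘ pr T) = D_t T · (D_t̃ G) ∘ pr T`. -/
theorem totalDeriv_comp_prolong {Ω V : Set (Jet 𝕜)} (hΩ : IsOpen Ω) (hV : IsOpen V)
    (hsub : Ω ⊆ τ.prolongDomain) {G : Jet 𝕜 → 𝕜} (hG : IsDifferentialFunction V G)
    (hm : Set.MapsTo τ.prolong Ω V) {z : Jet 𝕜} (hz : z ∈ Ω) :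
    totalDeriv (fun w => G (τ.prolong w)) z = totalDeriv τ.T z * totalDeriv G (τ.prolong z) := by
  refine totalDeriv_comp hΩ hV hG ⟨τ.isDifferentialMap_prolong.time.mono hsub,
    fun k => (τ.isDifferentialMap_prolong.coord k).mono hsub⟩ hm hz rfl fun k => ?_
  exact (mul_div_cancel₀ _ (hsub hz).2).symm

/-- The inverse point transformation. -/
def symm : PointTransformation 𝕜 := ⟨τ.toHomeo.symm, τ.smooth_symm, τ.smooth⟩

theorem mapsTo_prolong_baseDomain :
    Set.MapsTo τ.prolong τ.prolongDomain τ.symm.baseDomain :=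
  fun _ hz => τ.toHomeo.map_source hz.1

theorem symm_T_prolong {z : Jet 𝕜} (hz : z ∈ τ.prolongDomain) : τ.symm.T (τ.prolong z) = z.1 :=
  congrArg Prod.fst (τ.toHomeo.left_inv hz.1)

theorem totalDeriv_symm_T {z : Jet 𝕜} (hz : z ∈ τ.prolongDomain) :
    totalDeriv τ.T z * totalDeriv τ.symm.T (τ.prolong z) = 1 := by
  rw [← τ.totalDeriv_comp_prolong τ.isOpen_prolongDomain τ.symm.isOpen_baseDomain subset_rfl
    τ.symm.isDifferentialFunction_T τ.mapsTo_prolong_baseDomain hz, ← totalDeriv_time z]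
  exact totalDeriv_congr τ.isOpen_prolongDomain (isDifferentialFunction_time _)
    (fun w hw => τ.symm_T_prolong hw) hz

theorem mapsTo_prolong : Set.MapsTo τ.prolong τ.prolongDomain τ.symm.prolongDomain :=
  fun _ hz => ⟨τ.mapsTo_prolong_baseDomain hz, right_ne_zero_of_mul_eq_one (τ.totalDeriv_symm_T hz)⟩

theorem symm_transformedDeriv_prolong (k : ℕ) :
    ∀ z ∈ τ.prolongDomain, τ.symm.transformedDeriv k (τ.prolong z) = z.2 k := by
  induction k with
  | zero => exact fun z hz => congrArg Prod.snd (τ.toHomeo.left_inv hz.1)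
  | succ k ih =>
    intro z hz
    have h := τ.totalDeriv_comp_prolong τ.isOpen_prolongDomain τ.symm.isOpen_prolongDomain
      subset_rfl (τ.symm.isDifferentialFunction_transformedDeriv k) τ.mapsTo_prolong hz
    rw [totalDeriv_congr τ.isOpen_prolongDomain (isDifferentialFunction_coord _ k) ih hz,
      totalDeriv_coord] at h
    have h1 := τ.totalDeriv_symm_T hz
    change totalDeriv (τ.symm.transformedDeriv k) (τ.prolong z) /
      totalDeriv τ.symm.T (τ.prolong z) = _
    rw [div_eq_iff (right_ne_zero_of_mul_eq_one h1), h]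
    linear_combination -totalDeriv (τ.symm.transformedDeriv k) (τ.prolong z) * h1

/-- The prolongation of the inverse is the inverse of the prolongation. -/
theorem symm_prolong_prolong {z : Jet 𝕜} (hz : z ∈ τ.prolongDomain) :
    τ.symm.prolong (τ.prolong z) = z :=
  Prod.ext (τ.symm_T_prolong hz) (funext fun k => τ.symm_transformedDeriv_prolong k z hz)

theorem injOn_prolong : Set.InjOn τ.prolong τ.prolongDomain := fun z hz w hw h => by
  rw [← τ.symm_prolong_prolong hz, h, τ.symm_prolong_prolong hw]

theorem isOpen_image_prolong {Ω : Set (Jet 𝕜)} (hΩ : IsOpen Ω) (hsub : Ω ⊆ τ.prolongDomain) :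
    IsOpen (τ.prolong '' Ω) := by
  have : τ.prolong '' Ω = τ.symm.prolongDomain ∩ τ.symm.prolong ⁻¹' Ω := by
    ext w
    constructor
    · rintro ⟨z, hz, rfl⟩
      refine ⟨τ.mapsTo_prolong (hsub hz), ?_⟩
      rw [Set.mem_preimage, τ.symm_prolong_prolong (hsub hz)]
      exact hz
    · rintro ⟨hw, hz⟩
      exact ⟨_, hz, τ.symm.symm_prolong_prolong hw⟩
  rw [this]
  exact τ.symm.isDifferentialMap_prolong.continuousOn.isOpen_inter_preimage
    τ.symm.isOpen_prolongDomain hΩ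

/-- A differential function in the original variables is a differential function in the transformed
variables. -/
theorem isDifferentialFunction_image {Ω : Set (Jet 𝕜)} (hsub : Ω ⊆ τ.prolongDomain)
    {f F : Jet 𝕜 → 𝕜} (hf : IsDifferentialFunction Ω f) (hF : ∀ z ∈ Ω, F (τ.prolong z) = f z) :
    IsDifferentialFunction (τ.prolong '' Ω) F := by
  have hs : τ.prolong '' Ω ⊆ τ.symm.prolongDomain := by
    rintro _ ⟨z, hz, rfl⟩
    exact τ.mapsTo_prolong (hsub hz)
  have hφ : IsDifferentialMap (τ.prolong '' Ω) τ.symm.prolong :=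
    ⟨τ.symm.isDifferentialMap_prolong.time.mono hs,
      fun k => (τ.symm.isDifferentialMap_prolong.coord k).mono hs⟩
  refine (hf.comp hφ ?_).congr ?_
  · rintro _ ⟨z, hz, rfl⟩
    rw [τ.symm_prolong_prolong (hsub hz)]
    exact hz
  · rintro _ ⟨z, hz, rfl⟩
    rw [τ.symm_prolong_prolong (hsub hz)]
    exact hF z hz

end PointTransformation

section DifferentialFunctionRing

variable {𝕜 : Type*} [RCLike 𝕜] {Ω : Set (Jet 𝕜)}

/-- The ring of differential functions on `Ω`. -/
def diffRing (Ω : Set (Jet 𝕜)) : Subring (Ω → 𝕜) where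
  carrier := {f | ∃ F, IsDifferentialFunction Ω F ∧ ∀ z : Ω, f z = F z}
  mul_mem' := by
    rintro _ _ ⟨F, hF, h⟩ ⟨G, hG, h'⟩
    exact ⟨_, hF.mul hG, fun z => by simp [h, h']⟩
  one_mem' := ⟨_, isDifferentialFunction_const Ω 1, fun _ => rfl⟩
  add_mem' := by
    rintro _ _ ⟨F, hF, h⟩ ⟨G, hG, h'⟩
    exact ⟨_, hF.add hG, fun z => by simp [h, h']⟩
  zero_mem' := ⟨_, isDifferentialFunction_const Ω 0, fun _ => rfl⟩
  neg_mem' := by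
    rintro _ ⟨F, hF, h⟩
    exact ⟨_, (isDifferentialFunction_const Ω (-1)).mul hF, fun z => by simp [h]⟩

namespace diffRing

/-- The element of the ring of differential functions on `Ω` given by a function on the jet space. -/
def mk (F : Jet 𝕜 → 𝕜) (hF : IsDifferentialFunction Ω F) : diffRing Ω :=
  ⟨fun z => F z, F, hF, fun _ => rfl⟩

/-- Evaluation at a point. -/
def eval (z : Ω) : diffRing Ω →+* 𝕜 := (Pi.evalRingHom (fun _ : Ω => 𝕜) z).comp (diffRing Ω).subtype

@[simp]
theorem eval_mk (F : Jet 𝕜 → 𝕜) (hF : IsDifferentialFunction Ω F) (z : Ω) :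
    eval z (mk F hF) = F z := rfl

theorem ext_eval {f g : diffRing Ω} (h : ∀ z, eval z f = eval z g) : f = g :=
  Subtype.ext (funext h)

/-- A function on the jet space that extends an element of the ring. -/
def lift (f : diffRing Ω) : Jet 𝕜 → 𝕜 := f.2.choose

theorem isDifferentialFunction_lift (f : diffRing Ω) : IsDifferentialFunction Ω (lift f) :=
  f.2.choose_spec.1

theorem lift_apply (f : diffRing Ω) {z : Jet 𝕜} (hz : z ∈ Ω) : lift f z = eval ⟨z, hz⟩ f :=
  (f.2.choose_spec.2 ⟨z, hz⟩).symm

/-- The total derivative as a derivation of the ring of differential functions. -/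
def totalDerivation (hΩ : IsOpen Ω) : Derivation ℤ (diffRing Ω) (diffRing Ω) :=
  Derivation.mk'
    (AddMonoidHom.toIntLinearMap
      (AddMonoidHom.mk' (fun f => mk _ ((isDifferentialFunction_lift f).totalDeriv hΩ))
        fun f g => ext_eval fun z => by
          have hf := isDifferentialFunction_lift f
          have hg := isDifferentialFunction_lift g
          rw [map_add]
          simp only [eval_mk]
          rw [← totalDeriv_add hΩ hf hg z.2]
          refine totalDeriv_congr hΩ (hf.add hg) (fun w hw => ?_) z.2
          rw [lift_apply _ hw, lift_apply _ hw, lift_apply _ hw, map_add]))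
    fun f g => ext_eval fun z => by
      have hf := isDifferentialFunction_lift f
      have hg := isDifferentialFunction_lift g
      simp only [AddMonoidHom.coe_toIntLinearMap, AddMonoidHom.mk'_apply, smul_eq_mul, RingHom.map_add,
        RingHom.map_mul, eval_mk]
      have h : totalDeriv (lift (f * g)) z = totalDeriv (fun w => lift f w * lift g w) z := by
        refine totalDeriv_congr hΩ (hf.mul hg) (fun w hw => ?_) z.2
        rw [lift_apply _ hw, lift_apply _ hw, lift_apply _ hw, map_mul]
      rw [h, totalDeriv_mul hΩ hf hg z.2, lift_apply f z.2, lift_apply g z.2]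
      ring

theorem eval_totalDerivation (hΩ : IsOpen Ω) (f : diffRing Ω) {F : Jet 𝕜 → 𝕜}
    (hF : ∀ z : Ω, F z = eval z f) (z : Ω) :
    totalDeriv F z = eval z (totalDerivation hΩ f) :=
  totalDeriv_congr hΩ (isDifferentialFunction_lift f)
    (fun w hw => by rw [lift_apply f hw, ← hF]) z.2

/-- A nowhere vanishing differential function, as a unit of the ring. -/
def unitOf (f : diffRing Ω) (h : ∀ z, eval z f ≠ 0) : (diffRing Ω)ˣ where
  val := f
  inv := mk _ ((isDifferentialFunction_lift f).inv fun z hz => by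
    rw [lift_apply f hz]; exact h _)
  val_inv := ext_eval fun z => by
    rw [map_mul, eval_mk, lift_apply f z.2, map_one, mul_inv_cancel₀ (h z)]
  inv_val := ext_eval fun z => by
    rw [map_mul, eval_mk, lift_apply f z.2, map_one, inv_mul_cancel₀ (h z)]

theorem eval_inv (u : (diffRing Ω)ˣ) (z : Ω) :
    eval z ((u⁻¹ : (diffRing Ω)ˣ) : diffRing Ω) = (eval z (u : diffRing Ω))⁻¹ := by
  refine eq_inv_of_mul_eq_one_left ?_
  rw [← map_mul, Units.inv_mul, map_one]

theorem eq_zero_of_natCast_mul (n : ℕ) (r : diffRing Ω) (hn : n ≠ 0)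
    (h : (n : diffRing Ω) * r = 0) : r = 0 := by
  refine ext_eval fun z => ?_
  have := congrArg (eval z) h
  rw [map_mul, map_natCast, map_zero] at this
  rw [map_zero]
  exact (mul_eq_zero.mp this).resolve_left (Nat.cast_ne_zero.mpr hn)

/-- The derivation `δ` of the ring of differential functions on `Ω` corresponds to the total
derivative under the map `φ` of jet spaces. -/
def Corresponds (φ : Jet 𝕜 → Jet 𝕜) (δ : Derivation ℤ (diffRing Ω) (diffRing Ω)) : Prop :=
  ∀ (F : Jet 𝕜 → 𝕜) (f : diffRing Ω), (∀ z : Ω, F (φ z) = eval z f) →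
    ∀ z : Ω, totalDeriv F (φ z) = eval z (δ f)

namespace Corresponds

variable {φ : Jet 𝕜 → Jet 𝕜} {δ : Derivation ℤ (diffRing Ω) (diffRing Ω)}

theorem iterate (hφ : Corresponds φ δ) {F : Jet 𝕜 → 𝕜} {f : diffRing Ω}
    (hF : ∀ z : Ω, F (φ z) = eval z f) (j : ℕ) :
    ∀ z : Ω, totalDeriv^[j] F (φ z) = eval z (δ^[j] f) := by
  induction j with
  | zero => exact hF
  | succ j ih =>
    intro z
    rw [Function.iterate_succ_apply', Function.iterate_succ_apply']
    exact hφ _ _ ih z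

variable {p : ℕ} {l : Fin p → Jet 𝕜 → 𝕜} {r : Fin p → diffRing Ω}

theorem wronskian (hφ : Corresponds φ δ) (hl : ∀ s, ∀ z : Ω, l s (φ z) = eval z (r s)) (z : Ω) :
    wronskian l (φ z) = eval z (algWronskian δ r) := by
  rw [algWronskian, RingHom.map_det, InverseCL.wronskian]
  congr 1
  ext i j
  exact hφ.iterate (hl i) j z

theorem darbouxCoeff (hφ : Corresponds φ δ) (hl : ∀ s, ∀ z : Ω, l s (φ z) = eval z (r s))
    {w : (diffRing Ω)ˣ} (hw : (w : diffRing Ω) = algWronskian δ r) (i : Fin (p + 1)) (z : Ω) :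
    darbouxCoeff l i (φ z) = eval z (algDarbouxCoeff δ r w i) := by
  rw [algDarbouxCoeff, InverseCL.darbouxCoeff, map_mul, map_mul, eval_inv, hw, ← hφ.wronskian hl,
    div_eq_mul_inv, map_pow, map_neg, map_one, RingHom.map_det]
  congr 3
  ext s j
  exact hφ.iterate (hl s) _ z

theorem darbouxAdjoint (hφ : Corresponds φ δ) (hl : ∀ s, ∀ z : Ω, l s (φ z) = eval z (r s))
    {w : (diffRing Ω)ˣ} (hw : (w : diffRing Ω) = algWronskian δ r) {H : Jet 𝕜 → 𝕜}
    {h : diffRing Ω} (hH : ∀ z : Ω, H (φ z) = eval z h) (z : Ω) :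
    darbouxAdjoint l H (φ z) = eval z (algDarbouxAdjoint δ r w h) := by
  rw [algDarbouxAdjoint, LinearMap.sum_apply, map_sum, InverseCL.darbouxAdjoint, opAdjointApply]
  refine Finset.sum_congr rfl fun i _ => ?_
  rw [Module.End.mul_apply, neg_derivEnd_pow_apply, map_mul, map_pow, map_neg, map_one,
    LinearMap.mulLeft_apply]
  congr 1
  refine hφ.iterate (fun z => ?_) _ z
  rw [hφ.darbouxCoeff hl hw, hH, map_mul]

end Corresponds

theorem corresponds_id (hΩ : IsOpen Ω) : Corresponds id (totalDerivation hΩ) :=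
  fun _ f hF z => eval_totalDerivation hΩ f hF z

theorem corresponds_prolong (hΩ : IsOpen Ω) (τ : PointTransformation 𝕜) (hτ : Ω ⊆ τ.prolongDomain)
    (J : (diffRing Ω)ˣ) (hJ : ∀ z : Ω, totalDeriv τ.T z = eval z (J : diffRing Ω)) :
    Corresponds τ.prolong (((J⁻¹ : (diffRing Ω)ˣ) : diffRing Ω) • totalDerivation hΩ) := by
  intro F f hF z
  have hFd : IsDifferentialFunction (τ.prolong '' Ω) F :=
    τ.isDifferentialFunction_image hτ (isDifferentialFunction_lift f) fun w hw => by
      rw [lift_apply f hw, ← hF]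
  have h := τ.totalDeriv_comp_prolong hΩ (τ.isOpen_image_prolong hΩ hτ) hτ hFd
    (Set.mapsTo_image _ _) z.2
  rw [eval_totalDerivation hΩ f hF z] at h
  rw [Derivation.smul_apply, smul_eq_mul, map_mul, eval_inv, h, ← hJ,
    inv_mul_cancel_left₀ (hτ z.2).2]

end diffRing

end DifferentialFunctionRing

end

end InverseCL

open InverseCL InverseCL.diffRing in
theorem mainTheorem11 {𝕜 : Type*} [RCLike 𝕜] {p : ℕ}
    (Ω : Set (InverseCL.Jet 𝕜)) (hΩ : IsOpen Ω)
    (L : InverseCL.Jet 𝕜 → 𝕜) (l : Fin p → InverseCL.Jet 𝕜 → 𝕜) (H : InverseCL.Jet 𝕜 → 𝕜)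
    (hrep : InverseCL.IsRepresentation Ω L l H)
    (τ : InverseCL.PointTransformation 𝕜) (hτ : Ω ⊆ τ.prolongDomain)
    (Λ : InverseCL.Jet 𝕜 → 𝕜) (hΛ : InverseCL.IsDifferentialFunction Ω Λ)
    (hΛ0 : ∀ z ∈ Ω, Λ z ≠ 0)
    (L' : InverseCL.Jet 𝕜 → 𝕜) (hL' : InverseCL.IsDifferentialFunction (τ.prolong '' Ω) L')
    (hmap : ∀ z ∈ Ω, L' (τ.prolong z) = Λ z * L z) :
    IsOpen (τ.prolong '' Ω) ∧ Set.InjOn τ.prolong Ω ∧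
      ∃ (l' : Fin p → InverseCL.Jet 𝕜 → 𝕜) (H' : InverseCL.Jet 𝕜 → 𝕜),
        (∀ s, ∀ z ∈ Ω, l' s (τ.prolong z) = l s z / (Λ z * InverseCL.totalDeriv τ.T z)) ∧
        (∀ z ∈ Ω, H' (τ.prolong z) = Λ z * InverseCL.totalDeriv τ.T z ^ p * H z) ∧
        InverseCL.IsRepresentation (τ.prolong '' Ω) L' l' H' := by
  refine ⟨τ.isOpen_image_prolong hΩ hτ, τ.injOn_prolong.mono hτ, ?_⟩
  let J : (diffRing Ω)ˣ := unitOf (mk _ (τ.isDifferentialFunction_totalDeriv_T.mono hτ))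
    fun z => (hτ z.2).2
  let M : (diffRing Ω)ˣ := unitOf (mk Λ hΛ) fun z => hΛ0 z z.2
  let r : Fin p → diffRing Ω := fun s => mk (l s) (hrep.diff_l s)
  let h : diffRing Ω := mk H hrep.diff_H
  let D := totalDerivation hΩ
  let A : Derivation ℤ (diffRing Ω) (diffRing Ω) := ((J⁻¹ : (diffRing Ω)ˣ) : diffRing Ω) • D
  have hDA : ∀ x, D x = J * A x := fun x => (Units.mul_inv_cancel_left J (D x)).symm
  have hD : Corresponds id D := corresponds_id hΩ
  have hA : Corresponds τ.prolong A := corresponds_prolong hΩ τ hτ J fun _ => rfl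
  let r' : Fin p → diffRing Ω := fun s => (((M * J)⁻¹ : (diffRing Ω)ˣ) : diffRing Ω) * r s
  let h' : diffRing Ω := M * J ^ p * h
  let l' : Fin p → Jet 𝕜 → 𝕜 := fun s w => lift (r' s) (τ.symm.prolong w)
  let H' : Jet 𝕜 → 𝕜 := fun w => lift h' (τ.symm.prolong w)
  have hl : ∀ s, ∀ z : Ω, l s (id z) = eval z (r s) := fun _ _ => rfl
  have hl' : ∀ s, ∀ z : Ω, l' s (τ.prolong z) = eval z (r' s) := fun s z => by
    simp only [l', τ.symm_prolong_prolong (hτ z.2)]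
    exact lift_apply _ z.2
  have hH' : ∀ z : Ω, H' (τ.prolong z) = eval z h' := fun z => by
    simp only [H', τ.symm_prolong_prolong (hτ z.2)]
    exact lift_apply _ z.2
  let w : (diffRing Ω)ˣ := unitOf (algWronskian D r) fun z => by
    rw [← hD.wronskian hl]
    exact hrep.wronskian_ne_zero z z.2
  let w' : (diffRing Ω)ˣ := (∏ j : Fin p, (M * J)⁻¹ * J⁻¹ ^ (j : ℕ)) * w
  have hw' : (w' : diffRing Ω) = algWronskian A r' := (algWronskian_change J (M * J) hDA r).symm
  have ht : A (mk τ.T (τ.isDifferentialMap_prolong.time.mono hτ)) = 1 := ext_eval fun z => by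
    rw [← hA (fun w => w.1) _ (fun _ => rfl) z, totalDeriv_time, map_one]
  refine ⟨l', H', fun s z hz => ?_, fun z hz => ?_, hL', fun s => ?_, ?_, ?_, ?_⟩
  · rw [hl' s ⟨z, hz⟩, map_mul, eval_inv, div_eq_inv_mul]
    rfl
  · exact hH' ⟨z, hz⟩
  · exact τ.isDifferentialFunction_image hτ (isDifferentialFunction_lift (r' s)) fun z hz => by
      rw [lift_apply _ hz, ← hl']
  · exact τ.isDifferentialFunction_image hτ (isDifferentialFunction_lift h') fun z hz => by
      rw [lift_apply _ hz, ← hH']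
  · rintro _ ⟨z, hz, rfl⟩
    rw [hA.wronskian hl' ⟨z, hz⟩, ← hw']
    exact ((w'.isUnit.map (eval ⟨z, hz⟩))).ne_zero
  · rintro _ ⟨z, hz, rfl⟩
    rw [hmap z hz, hrep.eq z hz, hA.darbouxAdjoint hl' hw' hH' ⟨z, hz⟩,
      algDarbouxAdjoint_change J M hDA ht eq_zero_of_natCast_mul r r' (fun _ => rfl) w w' rfl hw',
      map_mul, ← hD.darbouxAdjoint hl (w := w) rfl (H := H) (fun _ => rfl) ⟨z, hz⟩]
    rfl
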